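/- Let $\mathcal H$ be a finite-dimensional complex Hilbert space, $\hat H$ a self-adjoint operator on $\mathcal H$, $\hbar>0$ and $\sigma\in\mathbb R$. Let $(\Omega,\mathcal F,\mathbb P,\{\mathcal F_t\}_{t\ge0})$ be a filtered probability space carrying a standard Brownian motion $\{W_t\}_{t\ge0}$ relative to $\{\mathcal F_t\}$ (continuous paths almost surely, adapted, $W_0=0$ almost surely, $W_t-W_s\sim N(0,t-s)$ and independent of $\mathcal F_s$ for $s<t$). Let $\{\hat\rho_t\}_{t\ge0}$ be an adapted process with almost surely continuous paths, whose values are operators on $\mathcal H$ with $\hat\rho_t\ge0$ and $\operatorname{tr}\hat\rho_t=1$ almost surely for every $t$ (the initial state $\hat\rho_0$ may be random). Suppose that it satisfies the energy-driven stochastic master equation $$\mathrm d\hat\rho_t=-\mathrm i\hbar^{-1}[\hat H,\hat\rho_t]\,\mathrm dt+\tfrac18\sigma^2\big(2\hat H\hat\rho_t\hat H-\hat H^2\hat\rho_t-\hat\rho_t\hat H^2\big)\mathrm dt+\tfrac12\sigma\big((\hat H-H_t)\hat\rho_t+\hat\rho_t(\hat H-H_t)\big)\mathrm dW_t,\qquad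 H_t=\operatorname{tr}\hat\rho_t\hat H,$$ in the It\^o sense, i.e. the corresponding integral equation on $[0,t]$ holds almost surely for every $t\ge0$. Then $\hat\rho_t$ is integrable for every $t\ge0$, and the mean state $\langle\hat\rho_t\rangle=\mathbb E[\hat\rho_t]$ is differentiable in $t$ on $[0,\infty)$ (one-sidedly at $t=0$) and satisfies, for all $t\ge0$, the linear master equation $$\frac{\mathrm d\langle\hat\rho_t\rangle}{\mathrm dt}=-\mathrm i\hbar^{-1}[\hat H,\langle\hat\rho_t\rangle]+\tfrac18\sigma^2\big(2\hat H\langle\hat\rho_t\rangle\hat H-\hat H^2\langle\hat\rho_t\rangle-\langle\hat\rho_t\rangle\hat H^2\big).$$ -/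

import Mathlib

open MeasureTheory ProbabilityTheory Filter Topology
open scoped NNReal ENNReal

namespace EnergyReduction

section Stochastic

variable {Ω : Type*} {mΩ : MeasurableSpace Ω}

/-- A standard Brownian motion `W` on the filtered probability space `(Ω, mΩ, P, 𝓕)`. -/
structure IsBrownianMotion (𝓕 : Filtration ℝ≥0 mΩ) (P : Measure Ω) (W : ℝ≥0 → Ω → ℝ) : Prop where
  adapted : StronglyAdapted 𝓕 W
  continuous : ∀ᵐ ω ∂P, Continuous (fun t => W t ω)
  zero : ∀ᵐ ω ∂P, W 0 ω = 0
  increment_law : ∀ s t : ℝ≥0, s < t →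
    HasLaw (fun ω => W t ω - W s ω) (gaussianReal 0 (t - s)) P
  increment_indep : ∀ s t : ℝ≥0, s < t →
    Indep (MeasurableSpace.comap (fun ω => W t ω - W s ω) inferInstance) (𝓕 s) P

variable {F : Type*} [NormedAddCommGroup F] [NormedSpace ℝ F]

/-- A simple (elementary predictable) process with values in `F`: on `(time i, time (i + 1)]`,
for `i < n`, it equals a bounded `𝓕 (time i)`-measurable random variable `value i`, and it
vanishes outside these intervals. -/
structure SimpleProcess (𝓕 : Filtration ℝ≥0 mΩ) (F : Type*) [NormedAddCommGroup F] where
  n : ℕ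
  time : ℕ → ℝ≥0
  time_mono : Monotone time
  value : ℕ → Ω → F
  value_measurable : ∀ i, StronglyMeasurable[𝓕 (time i)] (value i)
  value_bounded : ∀ i, ∃ C : ℝ, ∀ ω, ‖value i ω‖ ≤ C

/-- The value of a simple process at time `t`. -/
noncomputable def SimpleProcess.eval {𝓕 : Filtration ℝ≥0 mΩ} (X : SimpleProcess 𝓕 F)
    (t : ℝ≥0) (ω : Ω) : F :=
  ∑ i ∈ Finset.range X.n,
    (Set.Ioc (X.time i) (X.time (i + 1))).indicator (fun _ => X.value i ω) t

/-- The stochastic integral over `[0, t]` of a simple process against `W`. -/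
noncomputable def SimpleProcess.integral {𝓕 : Filtration ℝ≥0 mΩ} (X : SimpleProcess 𝓕 F)
    (W : ℝ≥0 → Ω → ℝ) (t : ℝ≥0) (ω : Ω) : F :=
  ∑ i ∈ Finset.range X.n,
    (W (min t (X.time (i + 1))) ω - W (min t (X.time i)) ω) • X.value i ω

/-- `Y` is (a version of) the Ito integral `∫₀ᵗ X_s dW_s` of the adapted, jointly measurable and
square integrable process `X`: the `L²(P)` limit of the integrals of simple processes that
converge to `X` in `L²([0, t] × Ω, ds ⊗ P)`. -/
structure IsItoIntegral (𝓕 : Filtration ℝ≥0 mΩ) (P : Measure Ω) (W : ℝ≥0 → Ω → ℝ)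
    (X : ℝ≥0 → Ω → F) (t : ℝ≥0) (Y : Ω → F) : Prop where
  adapted : StronglyAdapted 𝓕 X
  memLp : MemLp (fun p : ℝ × Ω => X p.1.toNNReal p.2) 2
    ((volume.restrict (Set.Icc (0 : ℝ) t)).prod P)
  measurable : AEStronglyMeasurable Y P
  limit : ∃ S : ℕ → SimpleProcess 𝓕 F,
    Tendsto (fun k => eLpNorm
      (fun p : ℝ × Ω => (S k).eval p.1.toNNReal p.2 - X p.1.toNNReal p.2) 2
      ((volume.restrict (Set.Icc (0 : ℝ) t)).prod P)) atTop (𝓝 0) ∧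
    Tendsto (fun k => eLpNorm (fun ω => (S k).integral W t ω - Y ω) 2 P) atTop (𝓝 0)

end Stochastic

section Quantum

variable {E : Type*} [NormedAddCommGroup E] [InnerProductSpace ℂ E]

/-- The linear superoperator
`X ↦ -i ħ⁻¹ [H, X] + (σ² / 8) (2 H X H - H² X - X H²)`. -/
noncomputable def lindbladian (ħ σ : ℝ) (H X : E →L[ℂ] E) : E →L[ℂ] E :=
  (-Complex.I * (ħ : ℂ)⁻¹) • (H * X - X * H)
    + (1 / 8 * (σ : ℂ) ^ 2) • ((2 : ℂ) • (H * X * H) - H ^ 2 * X - X * H ^ 2)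

/-- The expectation value `tr (X H)` of the energy in the state `X`. -/
noncomputable def energy (H X : E →L[ℂ] E) : ℂ :=
  LinearMap.trace ℂ E ((X * H : E →L[ℂ] E) : E →ₗ[ℂ] E)

/-- The nonlinear diffusion coefficient
`(σ / 2) ((H - tr (X H)) X + X (H - tr (X H)))`. -/
noncomputable def diffusionCoeff (σ : ℝ) (H X : E →L[ℂ] E) : E →L[ℂ] E :=
  (1 / 2 * (σ : ℂ)) • ((H - energy H X • 1) * X + X * (H - energy H X • 1))

variable {Ω : Type*} {mΩ : MeasurableSpace Ω}

/-- The process `ρ` is a density operator process: adapted, with continuous sample paths,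
nonnegative, and of unit trace. -/
structure IsStateProcess (𝓕 : Filtration ℝ≥0 mΩ) (P : Measure Ω)
    (ρ : ℝ≥0 → Ω → (E →L[ℂ] E)) : Prop where
  adapted : StronglyAdapted 𝓕 ρ
  continuous : ∀ᵐ ω ∂P, Continuous (fun t => ρ t ω)
  nonneg : ∀ t, ∀ᵐ ω ∂P, (ρ t ω).IsPositive
  trace_one : ∀ t, ∀ᵐ ω ∂P, LinearMap.trace ℂ E (ρ t ω : E →ₗ[ℂ] E) = 1

/-- The energy-driven stochastic master equation
`dρ_t = (-i ħ⁻¹ [H, ρ_t] + (σ² / 8) (2 H ρ_t H - H² ρ_t - ρ_t H²)) dt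
  + (σ / 2) ((H - H_t) ρ_t + ρ_t (H - H_t)) dW_t`, with `H_t = tr (ρ_t H)`, in the Ito sense, that
is, as an integral equation on each interval `[0, t]`. -/
def SatisfiesStochasticMasterEquation (𝓕 : Filtration ℝ≥0 mΩ) (P : Measure Ω)
    (W : ℝ≥0 → Ω → ℝ) (ħ σ : ℝ) (H : E →L[ℂ] E) (ρ : ℝ≥0 → Ω → (E →L[ℂ] E)) : Prop :=
  ∃ M : ℝ≥0 → Ω → (E →L[ℂ] E),
    (∀ t, IsItoIntegral 𝓕 P W (fun s ω => diffusionCoeff σ H (ρ s ω)) t (M t)) ∧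
    ∀ t : ℝ≥0, ∀ᵐ ω ∂P,
      ρ t ω = ρ 0 ω + (∫ s in (0 : ℝ)..t, lindbladian ħ σ H (ρ s.toNNReal ω)) + M t ω

/-- The mean state `⟨ρ_t⟩ = 𝔼[ρ_t]`. -/
noncomputable def meanState (P : Measure Ω) (ρ : ℝ≥0 → Ω → (E →L[ℂ] E)) (t : ℝ≥0) : E →L[ℂ] E :=
  ∫ ω, ρ t ω ∂P

end Quantum

end EnergyReduction

namespace EnergyReduction

section Stochastic

variable {Ω : Type*} {mΩ : MeasurableSpace Ω} {𝓕 : Filtration ℝ≥0 mΩ} {P : Measure Ω}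
  {W : ℝ≥0 → Ω → ℝ} {F : Type*} [NormedAddCommGroup F] [NormedSpace ℝ F]

/-! Take expectations in the integral equation. The Itô term, the only nonlinear one, has mean zero:
for simple integrands because Brownian increments are centred and independent of the past, in
general by an L² limit. The drift is linear in the state, so it commutes with expectation, and
Fubini gives a closed integral equation for the mean state. Its integrand is continuous, so the
fundamental theorem of calculus differentiates it. The bound ‖ρ‖ ≤ tr ρ = 1
(`norm_le_re_trace_of_isPositive`) supplies the integrability of the state and of the drift. -/

theorem integral_add_add {f g h : Ω → F} (hf : Integrable f P) (hg : Integrable g P)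
    (hh : Integrable h P) :
    ∫ ω, (f ω + g ω + h ω) ∂P = ∫ ω, f ω ∂P + ∫ ω, g ω ∂P + ∫ ω, h ω ∂P := by
  rw [integral_add (hf.fun_add hg) hh, integral_add hf hg]

/-- A Brownian increment is integrable. -/
theorem IsBrownianMotion.integrable_increment (hW : IsBrownianMotion 𝓕 P W) {s t : ℝ≥0}
    (hst : s < t) : Integrable (fun ω => W t ω - W s ω) P := by
  have h := hW.increment_law s t hst
  have hid : Integrable (fun x : ℝ => x) (P.map (fun ω => W t ω - W s ω)) := by
    rw [h.map_eq]
    exact (memLp_id_gaussianReal (μ := 0) (v := t - s) 1).integrable le_rfl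
  exact (integrable_map_measure hid.aestronglyMeasurable h.aemeasurable).1 hid

/-- A Brownian increment is centred. -/
theorem IsBrownianMotion.integral_increment (hW : IsBrownianMotion 𝓕 P W) {s t : ℝ≥0}
    (hst : s < t) : ∫ ω, (W t ω - W s ω) ∂P = 0 := by
  rw [(hW.increment_law s t hst).integral_eq, integral_id_gaussianReal]

/-- A Brownian increment is independent of every random variable measurable with respect to
the past. -/
theorem IsBrownianMotion.indepFun_increment (hW : IsBrownianMotion 𝓕 P W) {s t : ℝ≥0}
    (hst : s < t) {G : Type*} [NormedAddCommGroup G] [MeasurableSpace G] [BorelSpace G]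
    {v : Ω → G} (hv : StronglyMeasurable[𝓕 s] v) : IndepFun (fun ω => W t ω - W s ω) v P :=
  (IndepFun_iff_Indep _ _ _).2
    (indep_of_indep_of_le_right (hW.increment_indep s t hst) hv.measurable.comap_le)

/-- The product of a Brownian increment and a bounded random variable that is measurable with
respect to the past is integrable and centred. -/
theorem IsBrownianMotion.integrable_increment_smul_and_integral_eq_zero
    [IsProbabilityMeasure P] (hW : IsBrownianMotion 𝓕 P W) {s t : ℝ≥0} (hst : s < t)
    {v : Ω → F} (hv : StronglyMeasurable[𝓕 s] v) (hb : ∃ C : ℝ, ∀ ω, ‖v ω‖ ≤ C) :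
    Integrable (fun ω => (W t ω - W s ω) • v ω) P ∧
      ∫ ω, (W t ω - W s ω) • v ω ∂P = 0 := by
  let : MeasurableSpace F := borel F
  have : BorelSpace F := ⟨rfl⟩
  obtain ⟨C, hC⟩ := hb
  have hv' : AEStronglyMeasurable v P := (hv.mono (𝓕.le s)).aestronglyMeasurable
  have hind := hW.indepFun_increment hst hv
  have hint := hW.integrable_increment hst
  refine ⟨hind.integrable_smul hint (.of_bound hv' C (ae_of_all _ hC)), ?_⟩
  rw [hind.integral_fun_smul_eq_smul_integral hint.aestronglyMeasurable hv',
    hW.integral_increment hst, zero_smul]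

/-- The stochastic integral of a simple process is integrable and centred. -/
theorem SimpleProcess.integrable_integral_and_integral_eq_zero [IsProbabilityMeasure P]
    (hW : IsBrownianMotion 𝓕 P W) (X : SimpleProcess 𝓕 F) (t : ℝ≥0) :
    Integrable (X.integral W t) P ∧ ∫ ω, X.integral W t ω ∂P = 0 := by
  have key : ∀ i, Integrable (fun ω =>
        (W (min t (X.time (i + 1))) ω - W (min t (X.time i)) ω) • X.value i ω) P ∧
      ∫ ω, (W (min t (X.time (i + 1))) ω - W (min t (X.time i)) ω) • X.value i ω ∂P = 0 := by
    intro i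
    -- Truncation at `t` either empties the interval or leaves its left endpoint `X.time i`, where
    -- `X.value i` is known.
    rcases eq_or_lt_of_le (min_le_min_left t (X.time_mono i.le_succ)) with h | h
    · simp [Nat.succ_eq_add_one] at h
      simp [h]
    · have hi : min t (X.time i) = X.time i :=
        min_eq_right (not_lt.1 fun hlt => by
          simp [min_eq_left hlt.le] at h)
      rw [hi] at h ⊢
      exact hW.integrable_increment_smul_and_integral_eq_zero h (X.value_measurable i)
        (X.value_bounded i)
  refine ⟨integrable_finsetSum _ fun i _ => (key i).1, ?_⟩
  simp only [SimpleProcess.integral]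
  rw [integral_finsetSum _ fun i _ => (key i).1]
  exact Finset.sum_eq_zero fun i _ => (key i).2

/-- The Ito integral is integrable and centred. -/
theorem IsItoIntegral.integrable_and_integral_eq_zero [IsProbabilityMeasure P]
    (hW : IsBrownianMotion 𝓕 P W) {X : ℝ≥0 → Ω → F} {t : ℝ≥0} {Y : Ω → F}
    (hY : IsItoIntegral 𝓕 P W X t Y) : Integrable Y P ∧ ∫ ω, Y ω ∂P = 0 := by
  obtain ⟨S, -, hS⟩ := hY.limit
  have hSi := fun k => (S k).integrable_integral_and_integral_eq_zero hW t
  have hmeas : ∀ k, AEStronglyMeasurable (fun ω => (S k).integral W t ω - Y ω) P :=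
    fun k => (hSi k).1.aestronglyMeasurable.sub hY.measurable
  have hS1 : Tendsto (fun k => eLpNorm (fun ω => (S k).integral W t ω - Y ω) 1 P)
      atTop (𝓝 0) :=
    -- On a probability space the L¹ norm is at most the L² norm.
    tendsto_of_tendsto_of_tendsto_of_le_of_le tendsto_const_nhds hS (fun _ => zero_le)
      fun k => eLpNorm_le_eLpNorm_of_exponent_le (by norm_num) (hmeas k)
  have hYi : Integrable Y P := by
    obtain ⟨k, hk⟩ := (hS1.eventually_lt_const ENNReal.zero_lt_top).exists
    have h : Integrable (fun ω => (S k).integral W t ω - Y ω) P :=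
      memLp_one_iff_integrable.1 ⟨hmeas k, hk⟩
    exact ((hSi k).1.sub h).congr (ae_of_all _ fun ω => by simp)
  refine ⟨hYi, ?_⟩
  have hlim := tendsto_integral_of_L1' Y hYi.aestronglyMeasurable (Eventually.of_forall fun k => (hSi k).1) hS1
  simp only [(hSi _).2] at hlim
  exact (tendsto_nhds_unique hlim tendsto_const_nhds)

end Stochastic

section Quantum

variable {E : Type*} [NormedAddCommGroup E] [InnerProductSpace ℂ E]
  {Ω : Type*} {mΩ : MeasurableSpace Ω} {𝓕 : Filtration ℝ≥0 mΩ} {P : Measure Ω}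
  {ρ : ℝ≥0 → Ω → (E →L[ℂ] E)}

namespace IsStateProcess

theorem aestronglyMeasurable (hρ : IsStateProcess 𝓕 P ρ) (t : ℝ≥0) :
    AEStronglyMeasurable (ρ t) P :=
  ((hρ.adapted t).mono (𝓕.le t)).aestronglyMeasurable

/-- A state process is jointly measurable in time and randomness, up to a null set. -/
theorem aestronglyMeasurable_uncurry [SFinite P] (hρ : IsStateProcess 𝓕 P ρ) (ν : Measure ℝ) :
    AEStronglyMeasurable (fun p : ℝ × Ω => ρ p.1.toNNReal p.2) (ν.prod P) := by
  classical
  -- The set of discontinuous paths may fail to be measurable, so a measurable null superset is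
  -- used. Setting the process to zero there makes every path continuous.
  set N : Set Ω := toMeasurable P {ω | ¬ Continuous fun t => ρ t ω}
  have hN : MeasurableSet N := measurableSet_toMeasurable _ _
  have hN0 : P N = 0 := (measure_toMeasurable _).trans hρ.continuous
  let ρ' : ℝ≥0 → Ω → (E →L[ℂ] E) := fun t => Nᶜ.indicator (ρ t)
  have hmeas : StronglyMeasurable (Function.uncurry fun ω t => ρ' t ω) := by
    refine (stronglyMeasurable_uncurry_of_continuous_of_stronglyMeasurable (u := ρ')
      (fun ω => ?_) fun t => ?_).comp_measurable measurable_swap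
    · by_cases h : ω ∈ N
      · simpa [ρ', h] using continuous_const
      · have : Continuous fun t => ρ t ω := by
          by_contra hc
          exact h (subset_toMeasurable _ _ hc)
        simpa [ρ', h] using this
    · exact ((hρ.adapted t).mono (𝓕.le t)).indicator hN.compl
  refine ⟨fun p => ρ' p.1.toNNReal p.2, hmeas.comp_measurable
    (measurable_snd.prodMk (measurable_real_toNNReal.comp measurable_fst)), ?_⟩
  have hNae : ∀ᵐ ω ∂P, ω ∉ N := measure_eq_zero_iff_ae_notMem.1 hN0
  filter_upwards [Measure.quasiMeasurePreserving_snd.ae hNae] with p hp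
  simp [ρ', hp]

end IsStateProcess

variable [FiniteDimensional ℂ E]

/-- The operator norm of a positive operator is at most its trace. -/
theorem norm_le_re_trace_of_isPositive {A : E →L[ℂ] E} (hA : A.IsPositive) :
    ‖A‖ ≤ (LinearMap.trace ℂ E (A : E →ₗ[ℂ] E)).re := by
  have hpos := hA.toLinearMap
  have hsymm := hpos.isSymmetric
  have htr : (LinearMap.trace ℂ E (A : E →ₗ[ℂ] E)).re = _ := hsymm.re_trace_eq_sum_eigenvalues rfl
  have h0 := hpos.nonneg_eigenvalues rfl
  set b := hsymm.eigenvectorBasis rfl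
  set l := hsymm.eigenvalues rfl
  have hle : ∀ i, l i ≤ ∑ j, l j := fun i =>
    Finset.single_le_sum (fun j _ => h0 j) (Finset.mem_univ i)
  have htr0 : 0 ≤ ∑ j, l j := Finset.sum_nonneg fun j _ => h0 j
  have hinner : ∀ i x, inner ℂ (b i) (A x) = (l i : ℂ) * inner ℂ (b i) x := by
    intro i x
    rw [← ContinuousLinearMap.coe_coe, ← hsymm (b i) x, hsymm.apply_eigenvectorBasis,
      inner_smul_left]
    simp [b, l]
  rw [htr]
  refine A.opNorm_le_bound htr0 fun x => ?_
  refine le_of_sq_le_sq ?_ (by positivity)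
  -- Parseval in the eigenbasis reduces the bound to one on each eigenvalue.
  rw [mul_pow, ← b.sum_sq_norm_inner_right (A x), ← b.sum_sq_norm_inner_right x, Finset.mul_sum]
  refine Finset.sum_le_sum fun i _ => ?_
  rw [hinner, norm_mul, mul_pow]
  gcongr
  simpa [abs_of_nonneg (h0 i)] using hle i

/-- The superoperator `lindbladian` as a continuous linear map. -/
noncomputable def lindbladianCLM (ħ σ : ℝ) (H : E →L[ℂ] E) :
    (E →L[ℂ] E) →L[ℂ] (E →L[ℂ] E) :=
  LinearMap.toContinuousLinearMap
    { toFun := lindbladian ħ σ H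
      map_add' := fun X Y => by
        simp only [lindbladian, mul_add, add_mul]
        module
      map_smul' := fun c X => by
        simp only [lindbladian, mul_smul_comm, smul_mul_assoc, RingHom.id_apply]
        module }

@[simp]
theorem lindbladianCLM_apply (ħ σ : ℝ) (H X : E →L[ℂ] E) :
    lindbladianCLM ħ σ H X = lindbladian ħ σ H X := rfl

namespace IsStateProcess

theorem ae_norm_le_one (hρ : IsStateProcess 𝓕 P ρ) (t : ℝ≥0) : ∀ᵐ ω ∂P, ‖ρ t ω‖ ≤ 1 := by
  filter_upwards [hρ.nonneg t, hρ.trace_one t] with ω h1 h2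
  simpa [h2] using norm_le_re_trace_of_isPositive h1

/-- A countable dense set of times needs only one null set; path continuity extends the bound to all
times. -/
theorem ae_forall_norm_le_one (hρ : IsStateProcess 𝓕 P ρ) :
    ∀ᵐ ω ∂P, ∀ t, ‖ρ t ω‖ ≤ 1 := by
  obtain ⟨D, hD, hD'⟩ := TopologicalSpace.exists_countable_dense ℝ≥0
  filter_upwards [(ae_ball_iff hD).2 fun t _ => hρ.ae_norm_le_one t, hρ.continuous]
    with ω h hc t
  have hclosed : IsClosed {t | ‖ρ t ω‖ ≤ 1} := isClosed_le hc.norm continuous_const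
  exact hclosed.closure_subset_iff.2 h (hD' t)

theorem integrable [IsFiniteMeasure P] (hρ : IsStateProcess 𝓕 P ρ) (t : ℝ≥0) :
    Integrable (ρ t) P :=
  .of_bound (hρ.aestronglyMeasurable t) 1 (hρ.ae_norm_le_one t)

theorem continuous_meanState [IsFiniteMeasure P] (hρ : IsStateProcess 𝓕 P ρ) :
    Continuous (meanState P ρ) :=
  continuous_of_dominated (bound := fun _ => 1) hρ.aestronglyMeasurable hρ.ae_norm_le_one
    (integrable_const _) hρ.continuous

theorem integrable_uncurry [IsFiniteMeasure P] (hρ : IsStateProcess 𝓕 P ρ) (ν : Measure ℝ)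
    [IsFiniteMeasure ν] : Integrable (fun p : ℝ × Ω => ρ p.1.toNNReal p.2) (ν.prod P) :=
  .of_bound (hρ.aestronglyMeasurable_uncurry ν) 1
    ((Measure.quasiMeasurePreserving_snd.ae hρ.ae_forall_norm_le_one).mono fun _ h => h _)

/-- The mean state satisfies the linear master equation in integral form. -/
theorem meanState_eq_add_integral [IsProbabilityMeasure P] (hρ : IsStateProcess 𝓕 P ρ)
    {W : ℝ≥0 → Ω → ℝ} (hW : IsBrownianMotion 𝓕 P W) {ħ σ : ℝ} {H : E →L[ℂ] E}
    (hSME : SatisfiesStochasticMasterEquation 𝓕 P W ħ σ H ρ) (t : ℝ≥0) :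
    meanState P ρ t = meanState P ρ 0
      + ∫ s in (0 : ℝ)..t, lindbladian ħ σ H (meanState P ρ s.toNNReal) := by
  obtain ⟨M, hM, hρM⟩ := hSME
  obtain ⟨hMi, hM0⟩ := (hM t).integrable_and_integral_eq_zero hW
  have : IsFiniteMeasure (volume.restrict (Set.uIoc 0 (t : ℝ))) :=
    ⟨by simp [Set.uIoc]⟩
  have hdrift : Integrable
      (Function.uncurry fun (s : ℝ) ω => lindbladian ħ σ H (ρ s.toNNReal ω))
      ((volume.restrict (Set.uIoc 0 (t : ℝ))).prod P) :=
    (lindbladianCLM ħ σ H).integrable_comp (hρ.integrable_uncurry _)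
  have hdrift' : Integrable
      (fun ω => ∫ s in (0 : ℝ)..t, lindbladian ħ σ H (ρ s.toNNReal ω)) P := by
    have := hdrift.integral_prod_right
    simpa only [Set.uIoc_of_le t.coe_nonneg, intervalIntegral.integral_of_le t.coe_nonneg,
      Function.uncurry] using this
  calc meanState P ρ t
      = ∫ ω, (ρ 0 ω + (∫ s in (0 : ℝ)..t, lindbladian ħ σ H (ρ s.toNNReal ω)) + M t ω) ∂P :=
        integral_congr_ae (hρM t)
    _ = meanState P ρ 0 + ∫ s in (0 : ℝ)..t, ∫ ω, lindbladian ħ σ H (ρ s.toNNReal ω) ∂P := by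
        rw [integral_add_add (hρ.integrable 0) hdrift' hMi, hM0, add_zero, meanState,
          intervalIntegral_integral_swap hdrift]
    _ = _ := by
        -- Linearity of the drift lets the expectation pass inside.
        simp only [← lindbladianCLM_apply,
          (lindbladianCLM ħ σ H).integral_comp_comm (hρ.integrable _), meanState]

/-- The mean state is differentiable and satisfies the linear master equation. -/
theorem hasDerivWithinAt_meanState [IsProbabilityMeasure P] (hρ : IsStateProcess 𝓕 P ρ)
    {W : ℝ≥0 → Ω → ℝ} (hW : IsBrownianMotion 𝓕 P W) {ħ σ : ℝ} {H : E →L[ℂ] E}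
    (hSME : SatisfiesStochasticMasterEquation 𝓕 P W ħ σ H ρ) (t : ℝ≥0) :
    HasDerivWithinAt (fun s : ℝ => meanState P ρ s.toNNReal)
      (lindbladian ħ σ H (meanState P ρ t)) (Set.Ici 0) (t : ℝ) := by
  have hcont : Continuous fun s : ℝ => lindbladian ħ σ H (meanState P ρ s.toNNReal) :=
    (lindbladianCLM ħ σ H).continuous.comp
      (hρ.continuous_meanState.comp continuous_real_toNNReal)
  have hderiv := (hcont.integral_hasStrictDerivAt 0 (t : ℝ)).hasDerivAt.const_add
    (meanState P ρ 0)
  rw [Real.toNNReal_coe] at hderiv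
  -- For negative `s`, `toNNReal` freezes the mean state at time 0 and the integral equation may
  -- fail, hence the derivative within `Set.Ici 0`.
  have heq : ∀ s ∈ Set.Ici (0 : ℝ), meanState P ρ s.toNNReal = meanState P ρ 0
      + ∫ u in (0 : ℝ)..s, lindbladian ħ σ H (meanState P ρ u.toNNReal) := fun s hs => by
    simpa only [Real.coe_toNNReal s hs] using hρ.meanState_eq_add_integral hW hSME s.toNNReal
  exact hderiv.hasDerivWithinAt.congr heq (heq _ t.coe_nonneg)

end IsStateProcess

end Quantum

end EnergyReduction

theorem mainTheorem9
    {E : Type*} [NormedAddCommGroup E] [InnerProductSpace ℂ E] [CompleteSpace E]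
    [FiniteDimensional ℂ E]
    {Ω : Type*} {mΩ : MeasurableSpace Ω} (P : Measure Ω) [IsProbabilityMeasure P]
    (𝓕 : Filtration ℝ≥0 mΩ) (W : ℝ≥0 → Ω → ℝ)
    (hW : EnergyReduction.IsBrownianMotion 𝓕 P W)
    (ħ σ : ℝ) (hħ : 0 < ħ) (H : E →L[ℂ] E) (hH : IsSelfAdjoint H)
    (ρ : ℝ≥0 → Ω → (E →L[ℂ] E))
    (hρ : EnergyReduction.IsStateProcess 𝓕 P ρ)
    (hSME : EnergyReduction.SatisfiesStochasticMasterEquation 𝓕 P W ħ σ H ρ) :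
    (∀ t, Integrable (ρ t) P) ∧
    ∀ t : ℝ≥0,
      HasDerivWithinAt (fun s : ℝ => EnergyReduction.meanState P ρ s.toNNReal)
        ((-Complex.I * (ħ : ℂ)⁻¹) •
            (H * EnergyReduction.meanState P ρ t - EnergyReduction.meanState P ρ t * H)
          + (1 / 8 * (σ : ℂ) ^ 2) •
            ((2 : ℂ) • (H * EnergyReduction.meanState P ρ t * H)
              - H ^ 2 * EnergyReduction.meanState P ρ t
              - EnergyReduction.meanState P ρ t * H ^ 2))
        (Set.Ici 0) (t : ℝ) := by
  exact ⟨hρ.integrable, hρ.hasDerivWithinAt_meanState hW hSME⟩
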